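/- Let $p \ge 1$ and let $\mathcal A$ be a first-order $p$-stationary canonical linear iterative algorithm ($p$-SCLI), given by real scalars $\alpha_0,\dots,\alpha_{p-1},\beta_0,\dots,\beta_{p-1}$: for an operator $F:\mathbb R^n\to\mathbb R^n$ and initial points $z^{(0)},z^{(-1)},\dots,z^{(-p+1)}\in\mathbb R^n$ it generates the iterates $$z^{(t)}=\sum_{j=0}^{p-1}\Big(\alpha_j\,F\big(z^{(t-p+j)}\big)+\beta_j\,z^{(t-p+j)}\Big),\qquad t=1,2,\dots$$ Then there are constants $c_{\mathcal A}>0$ and $T_{\mathcal A}>0$, depending only on $\mathcal A$ (that is, on $p$ and the $\alpha_j,\beta_j$), with the following property. Let $n\ge 2$ be even, let $\ell,D>0$, write $z=(x,y)$ with $x,y\in\mathbb R^{n/2}$, and for $R>0$ let $\mathcal D_R=\{(x,y):\|x\|\le R,\ \|y\|\le R\}$. For every integer $T\ge T_{\mathcal A}$ there are a function $f(x,y)=x^\top M y+b_1^\top x+b_2^\top y$ on $\mathbb R^{n/2}\times\mathbb R^{n/2}$, whose min-max operator $F(x,y)=(\nabla_x f(x,y),-\nabla_y f(x,y))$ is $\ell$-Lipschitz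 in the Euclidean norm and which has a unique equilibrium (saddle point) $z^*$, with $z^*\in\mathcal D_D$; an initialization $z^{(0)},\dots,z^{(-p+1)}\in\mathcal D_D$; and some $T'\in\{T,T+1,\dots,T+p-1\}$ such that the iterates of $\mathcal A$ on $F$ satisfy $$\mathrm{Gap}_F^{\mathcal D_{2D}}\big(z^{(T')}\big)\ \ge\ \frac{c_{\mathcal A}\,\ell D^2}{\sqrt T}.$$ Here the total gap of the zero-sum game with costs $(f,-f)$ at $z=(x,y)$ is $$\mathrm{Gap}_F^{\mathcal D_{2D}}(x,y)=\Big(f(x,y)-\min_{\|x'\|\le 2D}f(x',y)\Big)+\Big(-f(x,y)-\min_{\|y'\|\le 2D}\big(-f(x,y')\big)\Big).$$ -/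

import Mathlib

/-- The action space `ℝ^m` of one player, with the Euclidean norm. -/
abbrev PlayerSpace (m : ℕ) : Type := EuclideanSpace ℝ (Fin m)

/-- The space `ℝ^n = ℝ^m × ℝ^m`, `n = 2m`, of action profiles `z = (x, y)`, with the Euclidean
(`ℓ²`) norm of `ℝ^n`. -/
abbrev ProfileSpace (m : ℕ) : Type := WithLp 2 (PlayerSpace m × PlayerSpace m)

/-- The box `𝓓_R = B(0, R) × B(0, R)` (closed Euclidean balls in `ℝ^m`). -/
def box (m : ℕ) (R : ℝ) : Set (ProfileSpace m) :=
  {z | z.fst ∈ Metric.closedBall (0 : PlayerSpace m) R ∧ z.snd ∈ Metric.closedBall (0 : PlayerSpace m) R}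

/-- The min-max gradient operator `F(x, y) = (∇ₓ f(x, y), -∇ᵧ f(x, y))` of an objective `f`
that the first player minimizes and the second player maximizes. -/
noncomputable def minMaxOperator {m : ℕ} (f : PlayerSpace m → PlayerSpace m → ℝ) (z : ProfileSpace m) :
    ProfileSpace m :=
  WithLp.toLp 2
    (gradient (fun x => f x z.snd) z.fst, -gradient (fun y => f z.fst y) z.snd)

/-- A (Nash) equilibrium of the zero-sum game with costs `(f, -f)`, i.e. a saddle point of `f`. -/
def IsEquilibrium {m : ℕ} (f : PlayerSpace m → PlayerSpace m → ℝ) (z : ProfileSpace m) : Prop :=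
  (∀ x' : PlayerSpace m, f z.fst z.snd ≤ f x' z.snd) ∧
    (∀ y' : PlayerSpace m, -f z.fst z.snd ≤ -f z.fst y')

/-- The total gap of the zero-sum game with costs `(f, -f)` at `z = (x, y)`, with respect to the
deviation sets `X` and `Y`: the sum over both players of the largest decrease of their own cost
that a deviation inside their set achieves. -/
noncomputable def totalGap {m : ℕ} (f : PlayerSpace m → PlayerSpace m → ℝ) (X Y : Set (PlayerSpace m))
    (z : ProfileSpace m) : ℝ :=
  (f z.fst z.snd - sInf ((fun x' => f x' z.snd) '' X)) +
    (-f z.fst z.snd - sInf ((fun y' => -f z.fst y') '' Y))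

/-- Bilinear objectives `f(x, y) = xᵀ M y + b₁ᵀ x + b₂ᵀ y`. -/
def IsBilinearObjective {m : ℕ} (f : PlayerSpace m → PlayerSpace m → ℝ) : Prop :=
  ∃ (M : Matrix (Fin m) (Fin m) ℝ) (b₁ b₂ : Fin m → ℝ), ∀ x y : PlayerSpace m,
    f x y = x.ofLp ⬝ᵥ M.mulVec y.ofLp + b₁ ⬝ᵥ x.ofLp + b₂ ⬝ᵥ y.ofLp

/-- `f` is a bilinear objective whose min-max operator is `ℓ`-Lipschitz and which has a unique
equilibrium, lying in the box `𝓓_D`. -/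
structure IsBilinearInstance {m : ℕ} (ℓ D : ℝ) (f : PlayerSpace m → PlayerSpace m → ℝ) : Prop where
  bilinear : IsBilinearObjective f
  lipschitz : ∀ z w : ProfileSpace m, ‖minMaxOperator f z - minMaxOperator f w‖ ≤ ℓ * ‖z - w‖
  equilibrium : ∃ z : ProfileSpace m,
    IsEquilibrium f z ∧ (∀ w : ProfileSpace m, IsEquilibrium f w → w = z) ∧ z ∈ box m D

/-- A first-order `p`-stationary canonical linear iterative algorithm (with linear coefficient
matrices), given by its scalar coefficients `α₀, …, α_{p-1}` and `β₀, …, β_{p-1}`. -/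
structure SCLI (p : ℕ) where
  α : Fin p → ℝ
  β : Fin p → ℝ

/-- `(z t)`, `t ≥ -p + 1`, are the iterates of the algorithm on the operator `F`, from the
initialization `z (-p + 1), …, z 0`:
`z t = ∑ j, (α j • F (z (t - p + j)) + β j • z (t - p + j))` for all `t ≥ 1`.
The values of `z` before time `-p + 1` play no role. -/
def SCLI.IsTrajectory {p : ℕ} (A : SCLI p) {V : Type*} [AddCommGroup V] [Module ℝ V]
    (F : V → V) (z : ℤ → V) : Prop :=
  ∀ t : ℤ, 1 ≤ t →
    z t = ∑ j : Fin p,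
      (A.α j • F (z (t - (p : ℤ) + ((j : ℕ) : ℤ))) + A.β j • z (t - (p : ℤ) + ((j : ℕ) : ℤ)))

/-!
The instances are `f(x, y) = ν⟨x - a, y⟩` with `0 < ν ≤ ℓ`, whose equilibrium is `z* = (a, 0)`. With
`(x, y)` read as `x + iy` in one coordinate, the operator is `z ↦ -iν(z - z*)`, so the error `z - z*`
obeys a scalar linear recurrence whose characteristic polynomial is
`q_ν(λ) = (λ^p - ∑ βⱼ λ^j) + iν ∑ αⱼ λ^j`, and the gap at `z` is at least `νD‖z - z*‖`
(`le_totalGap_shiftedInner`, `exists_instance_of_recurrence`). A root `w` of `q_ν` gives the error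
sequence `D w^t`, up to a shift of `t` that keeps the initialization in the box.

* If `ℓ|∑ αⱼ| > 2^p`, then `|q_ℓ(1)| > 2^p` and `q_ℓ` has a root of modulus at least `1`
  (`exists_root_one_le_norm`): at `ν = ℓ` the error does not decay, and the gap is at least `ℓD²`.
  What remains has `ℓ|∑ αⱼ|` bounded in terms of `p`, so constants can be uniform in `ℓ`.
* If `∑ βⱼ ≠ 1`, the stationary point of the algorithm differs from `z*` by a fixed fraction of
  `D`, and starting there again gives a gap of order `ℓD²`.
* If `∑ βⱼ = 1` and `∑ αⱼ = 0`, then `1` is a root of every `q_ν`.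
* If `∑ βⱼ = 1` and `∑ αⱼ ≠ 0`, then `q_ν` has a root of modulus at least `1 - Kν²` for small `ν`
  (`exists_root_imagPencil`). For `ν = ℓ/√T` the error after `T` steps is still of order `D`, and
  the gap is of order `νD² = ℓD²/√T`.
-/

/-! ### Roots of complex polynomials near the unit circle -/

open Polynomial in
/-- A monic complex polynomial of degree `d` is a product of `d` linear factors. -/
lemma exists_eq_prod_X_sub_C {q : ℂ[X]} (hq : q.Monic) {d : ℕ} (hd : q.natDegree = d) :
    ∃ r : Fin d → ℂ, q = ∏ i, (X - C (r i)) := by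
  have hs := IsAlgClosed.splits q
  have hl : q.roots.toList.length = d := by
    rw [Multiset.length_toList, ← hs.natDegree_eq_card_roots, hd]
  subst hl
  refine ⟨q.roots.toList.get, ?_⟩
  conv_lhs => rw [hs.eq_prod_roots_of_monic hq, ← Multiset.coe_toList q.roots]
  rw [Multiset.map_coe, Multiset.prod_coe]
  conv_lhs => rw [← List.ofFn_get q.roots.toList, List.map_ofFn, List.prod_ofFn]
  rfl

open Polynomial in
/-- The first two derivatives of a product of linear factors, in terms of the power sums of the
`(x - r i)⁻¹`. -/
lemma eval_derivative_prod_X_sub_C {ι : Type*} (s : Finset ι) (r : ι → ℂ) (x : ℂ)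
    (hx : ∀ i ∈ s, x - r i ≠ 0) :
    (derivative (∏ i ∈ s, (X - C (r i)))).eval x
        = (∏ i ∈ s, (x - r i)) * ∑ i ∈ s, (x - r i)⁻¹ ∧
      (derivative (derivative (∏ i ∈ s, (X - C (r i))))).eval x
        = (∏ i ∈ s, (x - r i)) * ((∑ i ∈ s, (x - r i)⁻¹) ^ 2 - ∑ i ∈ s, ((x - r i)⁻¹) ^ 2) := by
  classical
  induction s using Finset.induction_on with
  | empty => simp
  | insert a s ha ih =>
    obtain ⟨h1, h2⟩ := ih fun i hi => hx i (Finset.mem_insert_of_mem hi)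
    have h0 := hx a (Finset.mem_insert_self a s)
    have he : (∏ i ∈ s, (X - C (r i))).eval x = ∏ i ∈ s, (x - r i) := by
      simp [eval_prod]
    simp only [Finset.prod_insert ha, Finset.sum_insert ha]
    constructor
    · simp only [derivative_mul, derivative_sub, derivative_X, derivative_C, eval_add, eval_mul,
        eval_sub, eval_X, eval_C, h1, he]
      simp only [eval_one, eval_zero]
      field_simp
      ring
    · simp only [derivative_mul, derivative_sub, derivative_X, derivative_C, derivative_add, eval_add,
        eval_mul, eval_sub, eval_X, eval_C, h1, h2, he]
      simp only [derivative_one, derivative_zero, eval_one, eval_zero, sub_zero]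
      field_simp
      ring

open Polynomial in
/-- If all roots of `q` lay in the open unit disc, then `|q(1)| = ∏ |1 - r i| ≤ 2 ^ d`. -/
lemma exists_root_one_le_norm {q : ℂ[X]} (hq : q.Monic) {d : ℕ} (hd : q.natDegree = d)
    (h : 2 ^ d < ‖q.eval 1‖) : ∃ w : ℂ, q.eval w = 0 ∧ 1 ≤ ‖w‖ := by
  obtain ⟨r, hr⟩ := exists_eq_prod_X_sub_C hq hd
  by_contra! hcon
  have hroot : ∀ i, q.eval (r i) = 0 := fun i => by
    rw [hr, eval_prod]
    exact Finset.prod_eq_zero (Finset.mem_univ i) (by simp)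
  refine absurd h (not_lt.mpr ?_)
  rw [hr, eval_prod, norm_prod]
  calc ∏ i, ‖(X - C (r i)).eval 1‖ ≤ ∏ _i : Fin d, (2 : ℝ) := by
        refine Finset.prod_le_prod (fun i _ => norm_nonneg _) fun i _ => ?_
        have h1 := hcon _ (hroot i)
        have h2 := norm_sub_le (1 : ℂ) (r i)
        simp only [eval_sub, eval_X, eval_C]
        rw [norm_one] at h2
        linarith
    _ = 2 ^ d := by simp

/-- The Möbius map `w ↦ (1 - w)⁻¹` sends the open unit disc into the right half plane, and the
real part of the image controls the distance of `w` to the unit circle. -/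
lemma re_inv_one_sub {w : ℂ} (hw : ‖w‖ < 1) :
    0 < ((1 - w)⁻¹).re ∧
      (1 - ‖w‖) * (((1 - w)⁻¹).re ^ 2 + ((1 - w)⁻¹).im ^ 2) ≤ ((1 - w)⁻¹).re := by
  have hre : w.re ≤ ‖w‖ := Complex.re_le_norm w
  have hn : 0 < Complex.normSq (1 - w) := by
    rw [Complex.normSq_pos]
    intro h0
    have : w = 1 := (sub_eq_zero.mp h0).symm
    simp [this] at hw
  have h1 : ((1 - w)⁻¹).re = (1 - w.re) / Complex.normSq (1 - w) := by simp [Complex.inv_re]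
  have h2 : ((1 - w)⁻¹).re ^ 2 + ((1 - w)⁻¹).im ^ 2 = (Complex.normSq (1 - w))⁻¹ := by
    rw [← map_inv₀ Complex.normSq, Complex.normSq_apply]
    ring
  refine ⟨by rw [h1]; exact div_pos (by linarith) hn, ?_⟩
  rw [h2, h1, div_eq_mul_inv]
  exact mul_le_mul_of_nonneg_right (by linarith) (inv_nonneg.mpr hn.le)

open Polynomial in
/-- The one-parameter family `P + iνS` of complex polynomials attached to real polynomials
`P` and `S`. -/
noncomputable def imagPencil (P S : ℝ[X]) (ν : ℝ) : ℂ[X] :=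
  P.map (algebraMap ℝ ℂ) + C (Complex.I * ν) * S.map (algebraMap ℝ ℂ)

section

open Polynomial

lemma imagPencil_eval_one (P S : ℝ[X]) (ν : ℝ) :
    (imagPencil P S ν).eval 1 = P.eval 1 + Complex.I * ν * S.eval 1 := by
  have h : ∀ R : ℝ[X], (R.map (algebraMap ℝ ℂ)).eval 1 = (R.eval 1 : ℝ) := fun R => by
    have := eval_map_apply (f := algebraMap ℝ ℂ) (p := R) 1
    simpa using this
  simp [imagPencil, h]

lemma derivative_imagPencil (P S : ℝ[X]) (ν : ℝ) :
    derivative (imagPencil P S ν) = imagPencil (derivative P) (derivative S) ν := by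
  simp [imagPencil, derivative_map]

lemma imagPencil_degree_lt {P S : ℝ[X]} (hPS : S.degree < P.degree) (ν : ℝ) :
    (C (Complex.I * ν) * S.map (algebraMap ℝ ℂ)).degree < (P.map (algebraMap ℝ ℂ)).degree := by
  rw [degree_map]
  refine lt_of_le_of_lt ?_ hPS
  calc _ ≤ (C (Complex.I * ν)).degree + (S.map (algebraMap ℝ ℂ)).degree := degree_mul_le _ _
    _ ≤ 0 + S.degree := add_le_add degree_C_le degree_map_le
    _ = S.degree := zero_add _

lemma imagPencil_monic {P S : ℝ[X]} (hP : P.Monic) (hPS : S.degree < P.degree) (ν : ℝ) :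
    (imagPencil P S ν).Monic :=
  (hP.map _).add_of_left (imagPencil_degree_lt hPS ν)

lemma imagPencil_natDegree {P S : ℝ[X]} (hPS : S.degree < P.degree) (ν : ℝ) :
    (imagPencil P S ν).natDegree = P.natDegree := by
  rw [imagPencil, natDegree_add_eq_left_of_degree_lt (imagPencil_degree_lt hPS ν), natDegree_map]

/-- If `P(1) = 0` and `S(1) ≠ 0`, then for small `ν` the polynomial `P + iνS` has a root at
distance at most `O(ν²)` inside the unit circle; `1` may be a multiple root of `P`.

Suppose that all roots `r i` lie in the open disc and put `w i = (1 - r i)⁻¹`, which has positive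
real part. As `P` and `S` are real and `P(1) = 0`, the logarithmic derivatives at `1` show that
`Re ∑ w i = S'(1) / S(1)` and `Re ((∑ w i)² - ∑ (w i)²) = S''(1) / S(1)` do not depend on `ν`, while
`Im ∑ w i = -P'(1) / (ν S(1))`. Hence all `Re (w i)` are bounded. If `P'(1) ≠ 0`, some `w i` has
imaginary part of order `1/ν`, and `1 - |r i| ≤ Re (w i) / |w i|²` is `O(ν²)`. If `P'(1) = 0`, the
second identity bounds `∑ (Im (w i))²`, which contradicts `∏ |w i| = 1 / (ν |S(1)|)` for small
`ν`. -/
theorem exists_root_imagPencil {P S : ℝ[X]} (hP : P.Monic) (hPS : S.degree < P.degree)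
    (hP1 : P.eval 1 = 0) (hS1 : S.eval 1 ≠ 0) :
    ∃ K ν₁ : ℝ, 0 ≤ K ∧ 0 < ν₁ ∧ ∀ ν : ℝ, 0 < ν → ν < ν₁ →
      ∃ w : ℂ, (imagPencil P S ν).eval w = 0 ∧ 1 - K * ν ^ 2 ≤ ‖w‖ := by
  obtain ⟨d, hd⟩ : ∃ d, P.natDegree = d := ⟨_, rfl⟩
  obtain ⟨σ, hσ⟩ : ∃ σ, σ = S.eval 1 := ⟨_, rfl⟩
  rw [← hσ] at hS1
  obtain ⟨a, ha⟩ : ∃ a, a = (derivative P).eval 1 := ⟨_, rfl⟩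
  obtain ⟨b, hb⟩ : ∃ b, b = (derivative S).eval 1 := ⟨_, rfl⟩
  obtain ⟨c, hc⟩ : ∃ c, c = (derivative (derivative P)).eval 1 := ⟨_, rfl⟩
  obtain ⟨e, he⟩ : ∃ e, e = (derivative (derivative S)).eval 1 := ⟨_, rfl⟩
  obtain ⟨B, hB⟩ : ∃ B, B = (b / σ) ^ 2 + (|e / σ| + d * (b / σ) ^ 2) + 1 := ⟨_, rfl⟩
  have hBpos : 0 < B := by rw [hB]; positivity
  refine ⟨|b / σ| * (d ^ 2 * σ ^ 2 / a ^ 2), min 1 ((B⁻¹) ^ d / σ ^ 2), by positivity,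
    by positivity, fun ν hν hν1 => ?_⟩
  obtain ⟨r, hr⟩ := exists_eq_prod_X_sub_C (imagPencil_monic hP hPS ν)
    ((imagPencil_natDegree hPS ν).trans hd)
  by_contra! hcon
  have hK : 0 ≤ |b / σ| * (d ^ 2 * σ ^ 2 / a ^ 2) * ν ^ 2 := by positivity
  have hroot : ∀ i, (imagPencil P S ν).eval (r i) = 0 := fun i => by
    rw [hr, eval_prod]
    exact Finset.prod_eq_zero (Finset.mem_univ i) (by simp)
  have hlt : ∀ i, ‖r i‖ < 1 := fun i => by linarith [hcon _ (hroot i)]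
  set w : Fin d → ℂ := fun i => (1 - r i)⁻¹ with hw
  have hw0 : ∀ i, 0 < (w i).re := fun i => (re_inv_one_sub (hlt i)).1
  have hne : ∀ i ∈ Finset.univ, 1 - r i ≠ 0 := fun i _ h0 => by
    have := hw0 i
    simp [hw, h0] at this
  have hq : (imagPencil P S ν).eval 1 = ∏ i, (1 - r i) := by
    rw [hr, eval_prod]; simp
  obtain ⟨h1, h2⟩ := eval_derivative_prod_X_sub_C Finset.univ r 1 hne
  rw [← hr, ← hq, derivative_imagPencil] at h1 h2
  rw [derivative_imagPencil] at h2
  simp only [imagPencil_eval_one, hP1] at h1 h2 hq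
  rw [← ha, ← hb, ← hσ] at h1
  rw [← hc, ← he, ← hσ] at h2
  rw [← hσ] at hq
  set X₁ := ∑ i, (w i).re with hX₁
  set Y₁ := ∑ i, (w i).im with hY₁
  have hre : (∑ i, w i).re = X₁ := by simp [hX₁]
  have him : (∑ i, w i).im = Y₁ := by simp [hY₁]
  have hXval : X₁ = b / σ := by
    have := congrArg Complex.im h1
    change _ = ((_ : ℂ) * ∑ i, w i).im at this
    simp [Complex.mul_im, Complex.mul_re, hre, him] at this
    field_simp
    apply mul_left_cancel₀ hν.ne'
    linarith
  have hYval : a = -(ν * σ * Y₁) := by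
    have := congrArg Complex.re h1
    change _ = ((_ : ℂ) * ∑ i, w i).re at this
    simp [Complex.mul_im, Complex.mul_re, hre, him] at this
    linarith
  -- the second power sum: its real part does not depend on `ν`
  have hsq : X₁ ^ 2 - Y₁ ^ 2 - ∑ i, ((w i).re ^ 2 - (w i).im ^ 2) = e / σ := by
    have := congrArg Complex.im h2
    change _ = ((_ : ℂ) * ((∑ i, w i) ^ 2 - ∑ i, w i ^ 2)).im at this
    have hs2 : (∑ i, w i ^ 2).re = ∑ i, ((w i).re ^ 2 - (w i).im ^ 2) := by
      rw [Complex.re_sum]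
      exact Finset.sum_congr rfl fun i _ => by simp [pow_two]
    have hs1 : ((∑ i, w i) ^ 2).re = X₁ ^ 2 - Y₁ ^ 2 := by
      rw [pow_two, Complex.mul_re, hre, him]; ring
    rw [← hs1, ← hs2]
    generalize (∑ i, w i ^ 2) = Q at this ⊢
    simp only [Complex.mul_im, Complex.mul_re, Complex.add_im, Complex.add_re, Complex.ofReal_re,
      Complex.ofReal_im, Complex.I_re, Complex.I_im, Complex.sub_re, Complex.sub_im,
      Complex.ofReal_zero, Complex.zero_re, Complex.zero_im] at this
    simp at this
    rw [eq_div_iff hS1]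
    apply mul_left_cancel₀ hν.ne'
    simp only [hs1] at this ⊢
    linarith
  have hle : ∀ i, (w i).re ≤ b / σ := fun i => by
    rw [← hXval]
    exact Finset.single_le_sum (f := fun i => (w i).re) (fun j _ => (hw0 j).le) (Finset.mem_univ i)
  by_cases ha0 : a = 0
  · -- all `w i` are bounded, so `|q(1)| = ν|σ|` is bounded below
    have hY0 : Y₁ = 0 := by
      have : ν * σ * Y₁ = 0 := by linarith
      exact (mul_eq_zero.mp this).resolve_left (mul_ne_zero hν.ne' hS1)
    have hres : ∑ i, (w i).re ^ 2 ≤ d * (b / σ) ^ 2 := by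
      calc ∑ i, (w i).re ^ 2 ≤ ∑ _i : Fin d, (b / σ) ^ 2 :=
            Finset.sum_le_sum fun i _ => pow_le_pow_left₀ (hw0 i).le (hle i) 2
        _ = d * (b / σ) ^ 2 := by simp
    have hims : ∑ i, (w i).im ^ 2 ≤ |e / σ| + d * (b / σ) ^ 2 := by
      rw [Finset.sum_sub_distrib, hY0] at hsq
      nlinarith [le_abs_self (e / σ), sq_nonneg X₁]
    have hwB : ∀ i, B⁻¹ ≤ ‖1 - r i‖ ^ 2 := fun i => by
      have hi : (w i).im ^ 2 ≤ ∑ j, (w j).im ^ 2 :=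
        Finset.single_le_sum (f := fun j => (w j).im ^ 2) (fun j _ => sq_nonneg _)
          (Finset.mem_univ i)
      have hi2 : (w i).re ^ 2 ≤ (b / σ) ^ 2 := pow_le_pow_left₀ (hw0 i).le (hle i) 2
      have hn : ‖w i‖ ^ 2 ≤ B := by
        rw [← Complex.normSq_eq_norm_sq, Complex.normSq_apply]
        nlinarith
      have hpos : 0 < ‖1 - r i‖ ^ 2 := by
        have := norm_pos_iff.mpr (hne i (Finset.mem_univ i))
        positivity
      rw [hw, norm_inv, inv_pow] at hn
      exact inv_le_of_inv_le₀ hpos hn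
    have hprod : (B⁻¹) ^ d ≤ (ν * |σ|) ^ 2 := by
      have h3 := congrArg (fun z : ℂ => ‖z‖ ^ 2) hq
      simp only [norm_prod, ← Finset.prod_pow] at h3
      have h4 : ‖((0 : ℝ) : ℂ) + Complex.I * ν * σ‖ = ν * |σ| := by
        simp [abs_of_pos hν]
      rw [← h4, h3]
      calc (B⁻¹) ^ d = ∏ _i : Fin d, B⁻¹ := by simp
        _ ≤ _ := Finset.prod_le_prod (fun i _ => by positivity) fun i _ => hwB i
    have h5 : ν < 1 := lt_of_lt_of_le hν1 (min_le_left _ _)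
    have h6 : ν * σ ^ 2 < (B⁻¹) ^ d := by
      rw [← lt_div_iff₀ (by positivity)]
      exact lt_of_lt_of_le hν1 (min_le_right _ _)
    rw [mul_pow, sq_abs] at hprod
    have hσ2 : 0 < σ ^ 2 := by positivity
    have h7 : ν ^ 2 < ν := by rw [pow_two]; exact mul_lt_of_lt_one_right hν h5
    linarith [mul_lt_mul_of_pos_right h7 hσ2]
  · -- some `w i` has imaginary part of order `1/ν`
    have hdY : Y₁ ^ 2 ≤ d * ∑ i, (w i).im ^ 2 := by
      have := sq_sum_le_card_mul_sum_sq (s := (Finset.univ : Finset (Fin d)))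
        (f := fun i => (w i).im)
      simpa using this
    have hdpos : (0 : ℝ) < d := by
      rcases Nat.eq_zero_or_pos d with h0 | h0
      · have : Y₁ = 0 := by
          have hd0 : (d : ℝ) = 0 := by exact_mod_cast h0
          rw [hd0, zero_mul] at hdY
          exact pow_eq_zero_iff (two_ne_zero) |>.mp (le_antisymm hdY (sq_nonneg _))
        rw [this] at hYval
        simp at hYval
        exact absurd hYval ha0
      · exact_mod_cast h0
    obtain ⟨i, hi⟩ : ∃ i, Y₁ ^ 2 / d ^ 2 ≤ (w i).im ^ 2 := by
      by_contra! hno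
      have hsum : ∑ i, (w i).im ^ 2 < ∑ _i : Fin d, Y₁ ^ 2 / d ^ 2 := by
        refine Finset.sum_lt_sum_of_nonempty ?_ fun i _ => hno i
        have : 0 < d := by exact_mod_cast hdpos
        exact ⟨⟨0, this⟩, Finset.mem_univ _⟩
      simp only [Finset.sum_const, Finset.card_univ, Fintype.card_fin, nsmul_eq_mul] at hsum
      have := mul_lt_mul_of_pos_left hsum hdpos
      have h8 : (d : ℝ) * (d * (Y₁ ^ 2 / d ^ 2)) = Y₁ ^ 2 := by field_simp
      linarith
    have h9 := (re_inv_one_sub (hlt i)).2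
    change (1 - ‖r i‖) * ((w i).re ^ 2 + (w i).im ^ 2) ≤ (w i).re at h9
    have h10 := hcon _ (hroot i)
    have hY2 : 0 < Y₁ ^ 2 := by
      have : Y₁ ≠ 0 := fun h0 => ha0 (by rw [hYval, h0]; simp)
      positivity
    have hKeq : |b / σ| * (d ^ 2 * σ ^ 2 / a ^ 2) * ν ^ 2 = |b / σ| / (Y₁ ^ 2 / d ^ 2) := by
      have hYn : Y₁ ≠ 0 := fun h0 => by simp [h0] at hY2
      rw [hYval]
      field_simp
    have hquot : 0 < Y₁ ^ 2 / (d : ℝ) ^ 2 := by positivity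
    have h11 : |b / σ| / (Y₁ ^ 2 / d ^ 2) < 1 - ‖r i‖ := by rw [← hKeq]; linarith
    rw [div_lt_iff₀ hquot] at h11
    have h12 : (1 - ‖r i‖) * (Y₁ ^ 2 / d ^ 2)
        ≤ (1 - ‖r i‖) * ((w i).re ^ 2 + (w i).im ^ 2) :=
      mul_le_mul_of_nonneg_left (by linarith [sq_nonneg (w i).re]) (by linarith [hlt i])
    linarith [hle i, le_abs_self (b / σ)]

end

/-! ### The bilinear objective and its gap -/

/-- The objective `f(x, y) = ν⟨x - a, y⟩`, with equilibrium `(a, 0)`. -/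
noncomputable def shiftedInner {m : ℕ} (ν : ℝ) (a : PlayerSpace m) (x y : PlayerSpace m) : ℝ :=
  ν * inner ℝ (x - a) y

section

variable {m : ℕ} {ν : ℝ} {a : PlayerSpace m}

lemma minMaxOperator_shiftedInner (z : ProfileSpace m) :
    minMaxOperator (shiftedInner ν a) z
      = WithLp.toLp 2 (ν • z.snd, -(ν • (z.fst - a))) := by
  have h1 : HasGradientAt (fun x => shiftedInner ν a x z.snd) (ν • z.snd) z.fst := by
    rw [hasGradientAt_iff_hasFDerivAt]
    have h := ((InnerProductSpace.toDual ℝ (PlayerSpace m) (ν • z.snd)).hasFDerivAt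
      (x := z.fst)).sub_const (ν * inner ℝ a z.snd)
    refine h.congr_of_eventuallyEq (Filter.Eventually.of_forall fun x => ?_)
    change ν * inner ℝ (x - a) z.snd
      = InnerProductSpace.toDual ℝ (PlayerSpace m) (ν • z.snd) x - ν * inner ℝ a z.snd
    rw [InnerProductSpace.toDual_apply_apply, real_inner_smul_left, inner_sub_left,
      real_inner_comm x]
    ring
  have h2 : HasGradientAt (fun y => shiftedInner ν a z.fst y) (ν • (z.fst - a)) z.snd := by
    rw [hasGradientAt_iff_hasFDerivAt]
    have h := (InnerProductSpace.toDual ℝ (PlayerSpace m) (ν • (z.fst - a))).hasFDerivAt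
      (x := z.snd)
    refine h.congr_of_eventuallyEq (Filter.Eventually.of_forall fun y => ?_)
    change ν * inner ℝ (z.fst - a) y
      = InnerProductSpace.toDual ℝ (PlayerSpace m) (ν • (z.fst - a)) y
    rw [InnerProductSpace.toDual_apply_apply, real_inner_smul_left]
  rw [minMaxOperator, h1.gradient, h2.gradient]

lemma isEquilibrium_shiftedInner_iff (hν : 0 < ν) (w : ProfileSpace m) :
    IsEquilibrium (shiftedInner ν a) w ↔ w = WithLp.toLp 2 (a, 0) := by
  constructor
  · rintro ⟨h1, h2⟩
    have h3 := h1 (w.fst - w.snd)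
    have h4 := h2 (w.snd + (w.fst - a))
    have e1 : shiftedInner ν a (w.fst - w.snd) w.snd
        = shiftedInner ν a w.fst w.snd - ν * ‖w.snd‖ ^ 2 := by
      rw [shiftedInner, sub_right_comm, inner_sub_left, real_inner_self_eq_norm_sq, shiftedInner]
      ring
    have e2 : shiftedInner ν a w.fst (w.snd + (w.fst - a))
        = shiftedInner ν a w.fst w.snd + ν * ‖w.fst - a‖ ^ 2 := by
      rw [shiftedInner, inner_add_right, real_inner_self_eq_norm_sq, shiftedInner]
      ring
    have hy : ‖w.snd‖ ^ 2 = 0 :=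
      le_antisymm (nonpos_of_mul_nonpos_right (by linarith : ν * ‖w.snd‖ ^ 2 ≤ 0) hν)
        (sq_nonneg _)
    have hx : ‖w.fst - a‖ ^ 2 = 0 :=
      le_antisymm (nonpos_of_mul_nonpos_right (by linarith : ν * ‖w.fst - a‖ ^ 2 ≤ 0) hν)
        (sq_nonneg _)
    have hy0 : w.snd = 0 := by simpa using hy
    have hx0 : w.fst = a := by simpa [sub_eq_zero] using hx
    rw [← hx0, ← hy0]
    rfl
  · rintro rfl
    constructor <;> intro x' <;> simp [shiftedInner]

lemma isBilinearInstance_shiftedInner {ℓ D : ℝ} (hν : 0 < ν) (hνℓ : ν ≤ ℓ) (hD : 0 ≤ D)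
    (ha : ‖a‖ ≤ D) : IsBilinearInstance ℓ D (shiftedInner ν a) where
  bilinear := by
    refine ⟨ν • 1, 0, -(ν • a.ofLp), fun x y => ?_⟩
    simp only [shiftedInner, inner_sub_left, EuclideanSpace.inner_eq_star_dotProduct,
      Matrix.smul_mulVec, Matrix.one_mulVec, dotProduct_smul, zero_dotProduct, neg_dotProduct,
      smul_dotProduct, smul_eq_mul, star_trivial, dotProduct_comm y.ofLp]
    ring
  lipschitz z w := by
    have h : minMaxOperator (shiftedInner ν a) z - minMaxOperator (shiftedInner ν a) w
        = WithLp.toLp 2 (ν • (z - w).snd, -(ν • (z - w).fst)) := by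
      rw [minMaxOperator_shiftedInner, minMaxOperator_shiftedInner, ← WithLp.toLp_sub]
      congr 1
      refine Prod.ext ?_ ?_
      · change ν • z.snd - ν • w.snd = ν • (z.snd - w.snd)
        module
      · change -(ν • (z.fst - a)) - -(ν • (w.fst - a)) = -(ν • (z.fst - w.fst))
        module
    have hn : ‖(WithLp.toLp 2 (ν • (z - w).snd, -(ν • (z - w).fst)) : ProfileSpace m)‖
        = ν * ‖z - w‖ := by
      rw [WithLp.prod_norm_eq_of_L2, WithLp.prod_norm_eq_of_L2]
      change √(‖ν • (z - w).snd‖ ^ 2 + ‖-(ν • (z - w).fst)‖ ^ 2) = _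
      simp only [norm_neg, norm_smul, Real.norm_eq_abs, abs_of_pos hν]
      rw [mul_pow, mul_pow, ← mul_add, Real.sqrt_mul (sq_nonneg ν), Real.sqrt_sq hν.le, add_comm]
    rw [h, hn]
    exact mul_le_mul_of_nonneg_right hνℓ (norm_nonneg _)
  equilibrium := ⟨_, (isEquilibrium_shiftedInner_iff hν _).mpr rfl,
    fun w hw => (isEquilibrium_shiftedInner_iff hν w).mp hw, by simp [box, ha, hD]⟩

/-- Each player gains at least `νD` times the distance of the opponent from equilibrium: the
deviations `a - D y / ‖y‖` and `D (x - a) / ‖x - a‖` lie in the ball of radius `2D`. -/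
lemma le_totalGap_shiftedInner {D : ℝ} (hν : 0 < ν) (hD : 0 ≤ D) (ha : ‖a‖ ≤ D)
    (z : ProfileSpace m) :
    ν * D * (‖z.fst - a‖ + ‖z.snd‖) ≤ totalGap (shiftedInner ν a)
      (Metric.closedBall 0 (2 * D)) (Metric.closedBall 0 (2 * D)) z := by
  have hdir : ∀ v : PlayerSpace m, ‖(D * ‖v‖⁻¹) • v‖ ≤ D := fun v => by
    rw [norm_smul, norm_mul, norm_inv, norm_norm, Real.norm_eq_abs, abs_of_nonneg hD, mul_assoc]
    exact mul_le_of_le_one_right hD inv_mul_le_one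
  have hself : ∀ v : PlayerSpace m, D * ‖v‖⁻¹ * ‖v‖ ^ 2 = D * ‖v‖ := fun v => by
    rcases eq_or_ne ‖v‖ 0 with h | h
    · simp [h]
    · field_simp
  have hx : sInf ((fun x' => shiftedInner ν a x' z.snd) '' Metric.closedBall 0 (2 * D))
      ≤ -(ν * D * ‖z.snd‖) := by
    refine csInf_le ⟨-(ν * ((2 * D + D) * ‖z.snd‖)), ?_⟩
      ⟨a - (D * ‖z.snd‖⁻¹) • z.snd, ?_, ?_⟩
    · rintro _ ⟨x', hx', rfl⟩
      rw [mem_closedBall_zero_iff] at hx'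
      have h1 := abs_real_inner_le_norm (x' - a) z.snd
      have h2 : ‖x' - a‖ ≤ 2 * D + D := (norm_sub_le _ _).trans (add_le_add hx' ha)
      have h3 := mul_le_mul_of_nonneg_right h2 (norm_nonneg z.snd)
      have h4 := neg_abs_le (inner ℝ (x' - a) z.snd)
      simp only [shiftedInner, ← mul_neg]
      exact mul_le_mul_of_nonneg_left (by linarith) hν.le
    · rw [mem_closedBall_zero_iff]
      linarith [norm_sub_le a ((D * ‖z.snd‖⁻¹) • z.snd), hdir z.snd]
    · simp only [shiftedInner]
      rw [sub_right_comm, sub_self, zero_sub, inner_neg_left, real_inner_smul_left,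
        real_inner_self_eq_norm_sq, hself]
      ring
  have hy : sInf ((fun y' => -shiftedInner ν a z.fst y') '' Metric.closedBall 0 (2 * D))
      ≤ -(ν * D * ‖z.fst - a‖) := by
    refine csInf_le ⟨-(ν * (‖z.fst - a‖ * (2 * D))), ?_⟩
      ⟨(D * ‖z.fst - a‖⁻¹) • (z.fst - a), ?_, ?_⟩
    · rintro _ ⟨y', hy', rfl⟩
      rw [mem_closedBall_zero_iff] at hy'
      have h1 := real_inner_le_norm (z.fst - a) y'
      have h3 := mul_le_mul_of_nonneg_left hy' (norm_nonneg (z.fst - a))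
      simp only [shiftedInner]
      exact neg_le_neg (mul_le_mul_of_nonneg_left (h1.trans h3) hν.le)
    · rw [mem_closedBall_zero_iff]
      linarith [hdir (z.fst - a)]
    · simp only [shiftedInner]
      rw [real_inner_smul_right, real_inner_self_eq_norm_sq, hself]
      ring
  rw [totalGap]
  linarith

/-! ### Trajectories from scalar complex recurrences -/

/-- The real-linear embedding of `ℂ` into the space of profiles along the first coordinate of
each player: `w` goes to `(Re w, Im w)`. -/
noncomputable def complexProfile (m : ℕ) (hm : 1 ≤ m) (w : ℂ) : ProfileSpace m :=
  WithLp.toLp 2 (EuclideanSpace.single ⟨0, hm⟩ w.re, EuclideanSpace.single ⟨0, hm⟩ w.im)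

lemma complexProfile_add (hm : 1 ≤ m) (v w : ℂ) :
    complexProfile m hm (v + w) = complexProfile m hm v + complexProfile m hm w := by
  rw [complexProfile, complexProfile, complexProfile, ← WithLp.toLp_add]
  congr 2 <;> ext i <;> by_cases h : i = ⟨0, hm⟩ <;> simp [h]

lemma complexProfile_smul (hm : 1 ≤ m) (c : ℝ) (w : ℂ) :
    complexProfile m hm (c * w) = c • complexProfile m hm w := by
  rw [complexProfile, complexProfile, ← WithLp.toLp_smul]
  congr 2 <;> ext i <;> by_cases h : i = ⟨0, hm⟩ <;> simp [h]

lemma complexProfile_sum (hm : 1 ≤ m) {ι : Type*} (s : Finset ι) (g : ι → ℂ) :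
    complexProfile m hm (∑ i ∈ s, g i) = ∑ i ∈ s, complexProfile m hm (g i) :=
  map_sum (AddMonoidHom.mk' (complexProfile m hm) (complexProfile_add hm)) g s

/-- In the complex coordinate the min-max operator of `ν⟨x - s, y⟩` is multiplication by `-iν`
around the equilibrium `s`. -/
lemma minMaxOperator_complexProfile (hm : 1 ≤ m) (s : ℝ) (w : ℂ) :
    minMaxOperator (shiftedInner ν (EuclideanSpace.single ⟨0, hm⟩ s))
      (complexProfile m hm (w + s)) = complexProfile m hm (-(Complex.I * ν) * w) := by
  rw [minMaxOperator_shiftedInner]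
  simp only [complexProfile]
  congr 2
  · ext i
    simp [EuclideanSpace.single]
  · ext i
    by_cases h : i = ⟨0, hm⟩ <;> simp [EuclideanSpace.single, h]

end

/-- A scalar complex sequence `e` obeying the recurrence of the error `z - z*` along the
eigenvalue `-iν`, with forcing `(∑ βⱼ - 1)s`, yields a bilinear instance with equilibrium
`(s, 0)` and a trajectory whose gap at time `t` is at least `νD|e t|`. -/
lemma exists_instance_of_recurrence {p : ℕ} (A : SCLI p) {m : ℕ} (hm : 1 ≤ m) {ℓ D ν s : ℝ}
    (hD : 0 < D) (hν : 0 < ν) (hνℓ : ν ≤ ℓ) (hs : |s| ≤ D) (e : ℤ → ℂ)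
    (he : ∀ t : ℤ, 1 ≤ t → e t + s = ∑ j : Fin p,
      (((A.β j : ℂ) - Complex.I * ν * A.α j) * e (t - p + (j : ℕ)) + A.β j * s))
    (hinit : ∀ t : ℤ, -(p : ℤ) + 1 ≤ t → t ≤ 0 → ‖e t + s‖ ≤ D)
    (T : ℕ) {G : ℝ} (hG : G ≤ ν * D * ‖e T‖) :
    ∃ f : PlayerSpace m → PlayerSpace m → ℝ, IsBilinearInstance ℓ D f ∧
      ∃ z : ℤ → ProfileSpace m,
        A.IsTrajectory (minMaxOperator f) z ∧
        (∀ t : ℤ, -(p : ℤ) + 1 ≤ t → t ≤ 0 → z t ∈ box m D) ∧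
        G ≤ totalGap f (Metric.closedBall 0 (2 * D)) (Metric.closedBall 0 (2 * D)) (z T) := by
  have ha : ‖(EuclideanSpace.single ⟨0, hm⟩ s : PlayerSpace m)‖ ≤ D := by simpa using hs
  refine ⟨shiftedInner ν (EuclideanSpace.single ⟨0, hm⟩ s),
    isBilinearInstance_shiftedInner hν hνℓ hD.le ha, fun t => complexProfile m hm (e t + s),
    fun t ht => ?_, fun t ht0 ht1 => ?_, ?_⟩
  · simp only [minMaxOperator_complexProfile, ← complexProfile_smul, ← complexProfile_add,
      ← complexProfile_sum]
    rw [he t ht]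
    congr 1
    refine Finset.sum_congr rfl fun j _ => ?_
    ring
  · have h := hinit t ht0 ht1
    refine ⟨?_, ?_⟩
    · rw [mem_closedBall_zero_iff]
      refine le_trans ?_ h
      simpa [complexProfile] using Complex.abs_re_le_norm (e t + s)
    · rw [mem_closedBall_zero_iff]
      refine le_trans ?_ h
      simpa [complexProfile] using Complex.abs_im_le_norm (e t + s)
  · refine hG.trans (le_trans ?_ (le_totalGap_shiftedInner hν hD.le ha _))
    refine mul_le_mul_of_nonneg_left ?_ (by positivity)
    have h1 : ‖(complexProfile m hm (e T + s)).fst - EuclideanSpace.single ⟨0, hm⟩ s‖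
        = |(e T).re| := by
      have : (complexProfile m hm (e T + s)).fst - EuclideanSpace.single ⟨0, hm⟩ s
          = EuclideanSpace.single ⟨0, hm⟩ (e T).re := by
        ext i
        by_cases h : i = ⟨0, hm⟩ <;> simp [complexProfile, h]
      simp [this]
    have h2 : ‖(complexProfile m hm (e T + s)).snd‖ = |(e T).im| := by
      simp [complexProfile]
    rw [h1, h2]
    exact Complex.norm_le_abs_re_add_abs_im _

/-! ### The characteristic polynomial of an algorithm -/

namespace SCLI

open Polynomial

variable {p : ℕ} (A : SCLI p)

/-- `λ^p - ∑ βⱼ λ^j`, the characteristic polynomial of the recurrence at the zero operator. -/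
noncomputable def betaPoly : ℝ[X] := X ^ p - ∑ j : Fin p, C (A.β j) * X ^ (j : ℕ)

/-- `∑ αⱼ λ^j`. -/
noncomputable def alphaPoly : ℝ[X] := ∑ j : Fin p, C (A.α j) * X ^ (j : ℕ)

lemma degree_betaPoly : A.betaPoly.degree = p := by
  have h : (X ^ p : ℝ[X]).degree = p := degree_X_pow p
  rw [betaPoly, degree_sub_eq_left_of_degree_lt (by rw [h]; exact degree_sum_fin_lt _), h]

lemma betaPoly_monic : A.betaPoly.Monic :=
  (monic_X_pow p).sub_of_left (by rw [degree_X_pow]; exact degree_sum_fin_lt _)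

lemma natDegree_betaPoly : A.betaPoly.natDegree = p :=
  natDegree_eq_of_degree_eq_some A.degree_betaPoly

lemma degree_alphaPoly_lt : A.alphaPoly.degree < A.betaPoly.degree := by
  rw [degree_betaPoly]
  exact degree_sum_fin_lt _

lemma eval_betaPoly_one : A.betaPoly.eval 1 = 1 - ∑ j, A.β j := by
  simp [betaPoly, eval_finsetSum]

lemma eval_alphaPoly_one : A.alphaPoly.eval 1 = ∑ j, A.α j := by
  simp [alphaPoly, eval_finsetSum]

lemma pow_eq_of_isRoot {ν : ℝ} {w : ℂ}
    (hw : (imagPencil A.betaPoly A.alphaPoly ν).eval w = 0) :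
    w ^ p = ∑ j : Fin p, ((A.β j : ℂ) - Complex.I * ν * A.α j) * w ^ (j : ℕ) := by
  simp only [imagPencil, betaPoly, alphaPoly, Polynomial.map_sub, Polynomial.map_pow, map_X,
    Polynomial.map_sum, Polynomial.map_mul, map_C, eval_add, eval_sub, eval_pow, eval_X, eval_mul,
    eval_C, eval_finsetSum, Complex.coe_algebraMap] at hw
  simp only [sub_mul, Finset.sum_sub_distrib, mul_assoc, ← Finset.mul_sum] at hw ⊢
  linear_combination hw

/-- The geometric sequence attached to a nonzero root of the characteristic polynomial solves the
recurrence of the error with equilibrium at the origin. -/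
lemma recurrence_of_isRoot {ν : ℝ} {w : ℂ} (hw0 : w ≠ 0)
    (hw : (imagPencil A.betaPoly A.alphaPoly ν).eval w = 0) (D : ℝ) (k t : ℤ) :
    (D : ℂ) * w ^ (t + k) + (0 : ℝ) = ∑ j : Fin p,
      (((A.β j : ℂ) - Complex.I * ν * A.α j) * (D * w ^ (t - p + (j : ℕ) + k))
        + A.β j * (0 : ℝ)) := by
  have h := A.pow_eq_of_isRoot hw
  have e1 : w ^ (t + k) = w ^ (t + k - p) * w ^ p := by
    rw [← zpow_natCast, ← zpow_add₀ hw0]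
    congr 1
    ring
  rw [e1, h, Complex.ofReal_zero, add_zero, Finset.mul_sum, Finset.mul_sum]
  refine Finset.sum_congr rfl fun j _ => ?_
  have e2 : w ^ (t - p + (j : ℕ) + k) = w ^ (t + k - p) * w ^ (j : ℕ) := by
    rw [← zpow_natCast, ← zpow_add₀ hw0]
    congr 1
    ring
  rw [e2]
  ring

/-- A root on or outside the unit circle prevents any decay of the gap. -/
lemma exists_instance_of_one_le_norm {m : ℕ} (hm : 1 ≤ m) {ℓ D : ℝ} (hD : 0 < D)
    {ν : ℝ} (hν : 0 < ν) (hνℓ : ν ≤ ℓ) {w : ℂ}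
    (hw : (imagPencil A.betaPoly A.alphaPoly ν).eval w = 0) (hw1 : 1 ≤ ‖w‖) (T : ℕ) {G : ℝ}
    (hG : G ≤ ν * D ^ 2) :
    ∃ f : PlayerSpace m → PlayerSpace m → ℝ, IsBilinearInstance ℓ D f ∧
      ∃ z : ℤ → ProfileSpace m,
        A.IsTrajectory (minMaxOperator f) z ∧
        (∀ t : ℤ, -(p : ℤ) + 1 ≤ t → t ≤ 0 → z t ∈ box m D) ∧
        G ≤ totalGap f (Metric.closedBall 0 (2 * D)) (Metric.closedBall 0 (2 * D)) (z T) := by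
  have hw0 : w ≠ 0 := norm_pos_iff.mp (by linarith)
  refine exists_instance_of_recurrence A hm (s := 0) hD hν hνℓ (by simpa using hD.le)
    (fun t => D * w ^ (t + 0)) (fun t _ => A.recurrence_of_isRoot hw0 hw D 0 t)
    (fun t _ ht => ?_) T ?_
  · simp only [Complex.ofReal_zero, add_zero, norm_mul, Complex.norm_real, Real.norm_eq_abs,
      abs_of_pos hD, norm_zpow]
    exact mul_le_of_le_one_right hD.le (zpow_le_one_of_nonpos₀ hw1 ht)
  · simp only [add_zero, norm_mul, Complex.norm_real, Real.norm_eq_abs, abs_of_pos hD,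
      zpow_natCast, norm_pow]
    calc G ≤ ν * D ^ 2 := hG
      _ ≤ ν * D ^ 2 * ‖w‖ ^ T := le_mul_of_one_le_right (by positivity) (one_le_pow₀ hw1)
      _ = ν * D * (D * ‖w‖ ^ T) := by ring

/-- A nonzero root `w` inside the unit disc makes the error at time `T` at least
`D |w| ^ (T + p - 1)`. -/
lemma exists_instance_of_norm_le_one (hp : 1 ≤ p) {m : ℕ} (hm : 1 ≤ m) {ℓ D : ℝ} (hD : 0 < D)
    {ν : ℝ} (hν : 0 < ν) (hνℓ : ν ≤ ℓ) {w : ℂ}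
    (hw : (imagPencil A.betaPoly A.alphaPoly ν).eval w = 0) (hw0 : w ≠ 0) (hw1 : ‖w‖ ≤ 1)
    (T : ℕ) {G : ℝ} (hG : G ≤ ν * D * (D * ‖w‖ ^ (T + (p - 1)))) :
    ∃ f : PlayerSpace m → PlayerSpace m → ℝ, IsBilinearInstance ℓ D f ∧
      ∃ z : ℤ → ProfileSpace m,
        A.IsTrajectory (minMaxOperator f) z ∧
        (∀ t : ℤ, -(p : ℤ) + 1 ≤ t → t ≤ 0 → z t ∈ box m D) ∧
        G ≤ totalGap f (Metric.closedBall 0 (2 * D)) (Metric.closedBall 0 (2 * D)) (z T) := by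
  refine exists_instance_of_recurrence A hm (s := 0) hD hν hνℓ (by simpa using hD.le)
    (fun t => D * w ^ (t + ((p - 1 : ℕ) : ℤ)))
    (fun t _ => A.recurrence_of_isRoot hw0 hw D _ t) (fun t ht _ => ?_) T ?_
  · simp only [Complex.ofReal_zero, add_zero, norm_mul, Complex.norm_real, Real.norm_eq_abs,
      abs_of_pos hD, norm_zpow]
    obtain ⟨k, hk⟩ := Int.eq_ofNat_of_zero_le (a := t + ((p - 1 : ℕ) : ℤ)) (by omega)
    rw [hk, zpow_natCast]
    exact mul_le_of_le_one_right hD.le (pow_le_one₀ (norm_nonneg _) hw1)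
  · simp only [norm_mul, Complex.norm_real, Real.norm_eq_abs, abs_of_pos hD, norm_zpow]
    rw [← Nat.cast_add, zpow_natCast]
    exact hG

/-- A solution `e` of `(1 - ∑ βⱼ + iν∑ αⱼ) e = -(1 - ∑ βⱼ) s` is the displacement, from the
equilibrium `(s, 0)`, of a stationary point of the algorithm. Initialized there, the iterates are
constant and their gap is at least `νD|e|`. -/
lemma exists_instance_of_stationary {m : ℕ} (hm : 1 ≤ m) {ℓ D : ℝ} (hD : 0 < D)
    {ν s : ℝ} (hν : 0 < ν) (hνℓ : ν ≤ ℓ) (hs : |s| ≤ D) {e : ℂ}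
    (he : (imagPencil A.betaPoly A.alphaPoly ν).eval 1 * e = -(A.betaPoly.eval 1 : ℝ) * s)
    (hes : ‖e + s‖ ≤ D) (T : ℕ) {G : ℝ} (hG : G ≤ ν * D * ‖e‖) :
    ∃ f : PlayerSpace m → PlayerSpace m → ℝ, IsBilinearInstance ℓ D f ∧
      ∃ z : ℤ → ProfileSpace m,
        A.IsTrajectory (minMaxOperator f) z ∧
        (∀ t : ℤ, -(p : ℤ) + 1 ≤ t → t ≤ 0 → z t ∈ box m D) ∧
        G ≤ totalGap f (Metric.closedBall 0 (2 * D)) (Metric.closedBall 0 (2 * D)) (z T) := by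
  refine exists_instance_of_recurrence A hm hD hν hνℓ hs (fun _ => e) (fun t _ => ?_)
    (fun _ _ _ => hes) T hG
  rw [imagPencil_eval_one, eval_betaPoly_one, eval_alphaPoly_one] at he
  push_cast at he
  rw [Finset.sum_add_distrib, ← Finset.sum_mul, ← Finset.sum_mul, Finset.sum_sub_distrib,
    ← Finset.mul_sum]
  linear_combination he

end SCLI

/-! ### The lower bound -/

theorem theorem3 (p : ℕ) (hp : 1 ≤ p) (A : SCLI p) :
    ∃ (c : ℝ) (T₀ : ℕ), 0 < c ∧ 0 < T₀ ∧
      ∀ (m : ℕ), 1 ≤ m → ∀ (ℓ D : ℝ), 0 < ℓ → 0 < D → ∀ T : ℕ, T₀ ≤ T →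
        ∃ f : PlayerSpace m → PlayerSpace m → ℝ, IsBilinearInstance ℓ D f ∧
          ∃ z : ℤ → ProfileSpace m,
            A.IsTrajectory (minMaxOperator f) z ∧
            (∀ t : ℤ, -(p : ℤ) + 1 ≤ t → t ≤ 0 → z t ∈ box m D) ∧
            ∃ T' : ℕ, T ≤ T' ∧ T' ≤ T + p - 1 ∧
              c * ℓ * D ^ 2 / Real.sqrt (T : ℝ) ≤
                totalGap f (Metric.closedBall 0 (2 * D)) (Metric.closedBall 0 (2 * D))
                  (z (T' : ℤ)) := by
  -- the bound already holds at `T' = T`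
  suffices h : ∃ (c : ℝ) (T₀ : ℕ), 0 < c ∧ 0 < T₀ ∧
      ∀ (m : ℕ), 1 ≤ m → ∀ (ℓ D : ℝ), 0 < ℓ → 0 < D → ∀ T : ℕ, T₀ ≤ T →
        ∃ f : PlayerSpace m → PlayerSpace m → ℝ, IsBilinearInstance ℓ D f ∧
          ∃ z : ℤ → ProfileSpace m,
            A.IsTrajectory (minMaxOperator f) z ∧
            (∀ t : ℤ, -(p : ℤ) + 1 ≤ t → t ≤ 0 → z t ∈ box m D) ∧
            c * ℓ * D ^ 2 / Real.sqrt (T : ℝ) ≤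
              totalGap f (Metric.closedBall 0 (2 * D)) (Metric.closedBall 0 (2 * D))
                (z (T : ℤ)) by
    obtain ⟨c, T₀, hc, hT₀, h⟩ := h
    refine ⟨c, T₀, hc, hT₀, fun m hm ℓ D hℓ hD T hT => ?_⟩
    obtain ⟨f, hf, z, hz, hz0, hgap⟩ := h m hm ℓ D hℓ hD T hT
    exact ⟨f, hf, z, hz, hz0, T, le_rfl, by omega, hgap⟩
  have hlarge : ∀ {c : ℝ}, 0 < c → ∀ {ℓ D : ℝ}, 0 < ℓ → 0 < D → ∀ {T : ℕ}, 1 ≤ T →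
      c * ℓ * D ^ 2 / Real.sqrt T ≤ c * ℓ * D ^ 2 := fun {c} hc {ℓ D} hℓ hD {T} hT =>
    div_le_self (by positivity) (Real.one_le_sqrt.mpr (by exact_mod_cast hT))
  obtain ⟨σ, hσ⟩ : ∃ σ, σ = A.alphaPoly.eval 1 := ⟨_, rfl⟩
  obtain ⟨δ, hδ⟩ : ∃ δ, δ = A.betaPoly.eval 1 := ⟨_, rfl⟩
  have hev : ∀ ν : ℝ, (imagPencil A.betaPoly A.alphaPoly ν).eval 1
      = δ + Complex.I * ν * σ := fun ν => by rw [imagPencil_eval_one, hσ, hδ]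
  -- for large `ℓ|∑ αⱼ|` the algorithm is unstable
  have hunstable : ∀ ℓ : ℝ, 0 < ℓ → 2 ^ p < ℓ * |σ| →
      ∃ w : ℂ, (imagPencil A.betaPoly A.alphaPoly ℓ).eval w = 0 ∧ 1 ≤ ‖w‖ := by
    intro ℓ hℓ h
    refine exists_root_one_le_norm (imagPencil_monic A.betaPoly_monic A.degree_alphaPoly_lt ℓ)
      ((imagPencil_natDegree A.degree_alphaPoly_lt ℓ).trans A.natDegree_betaPoly)
      (lt_of_lt_of_le h ?_)
    rw [hev]
    have := Complex.abs_im_le_norm ((δ : ℂ) + Complex.I * ℓ * σ)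
    simpa [abs_mul, abs_of_pos hℓ] using this
  by_cases hδ0 : δ = 0
  · by_cases hσ0 : σ = 0
    · -- `1` is a root at every frequency, so constant sequences are trajectories
      refine ⟨1, 1, one_pos, one_pos, fun m hm ℓ D hℓ hD T hT => ?_⟩
      refine A.exists_instance_of_one_le_norm hm hD hℓ le_rfl (w := 1) ?_ (by simp) T
        ((hlarge one_pos hℓ hD hT).trans (by rw [one_mul]))
      rw [hev, hδ0, hσ0]
      simp
    · obtain ⟨K, ν₁, hK, hν₁, hroot⟩ := exists_root_imagPencil A.betaPoly_monic
        A.degree_alphaPoly_lt (hδ ▸ hδ0) (hσ ▸ hσ0)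
      have hσpos : 0 < |σ| := abs_pos.mpr hσ0
      obtain ⟨L, hL⟩ : ∃ L : ℝ, L = 2 ^ p / |σ| := ⟨_, rfl⟩
      have hLpos : 0 < L := by rw [hL]; positivity
      refine ⟨Real.exp (-(4 * (K * L ^ 2))),
        p + ⌈2 * (K * L ^ 2)⌉₊ + (⌈(L / ν₁) ^ 2⌉₊ + 1), Real.exp_pos _, by omega,
        fun m hm ℓ D hℓ hD T hT => ?_⟩
      have hc1 : Real.exp (-(4 * (K * L ^ 2))) ≤ 1 := by
        rw [Real.exp_le_one_iff]
        have : 0 ≤ K * L ^ 2 := by positivity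
        linarith
      have hT1 : 1 ≤ T := by omega
      rcases lt_or_ge (2 ^ p) (ℓ * |σ|) with h | h
      · obtain ⟨w, hw, hw1⟩ := hunstable ℓ hℓ h
        refine A.exists_instance_of_one_le_norm hm hD hℓ le_rfl hw hw1 T
          ((hlarge (Real.exp_pos _) hℓ hD hT1).trans ?_)
        rw [mul_assoc]
        exact mul_le_of_le_one_left (by positivity) hc1
      · have hℓL : ℓ ≤ L := by rw [hL, le_div_iff₀ hσpos]; exact h
        have hTpos : (0 : ℝ) < T := by exact_mod_cast hT1
        have hsq : 0 < Real.sqrt T := Real.sqrt_pos.mpr hTpos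
        -- the gap is of order `ν D |z - z*|`, and a loss of `O(ν²)` in modulus per step leaves
        -- `|z - z*|` of order `D` for `T` steps exactly when `ν = O(1 / √T)`
        obtain ⟨ν, hν⟩ : ∃ ν, ν = ℓ / Real.sqrt T := ⟨_, rfl⟩
        have hνpos : 0 < ν := by rw [hν]; positivity
        have hνℓ : ν ≤ ℓ := by
          rw [hν]
          exact div_le_self hℓ.le (Real.one_le_sqrt.mpr (by exact_mod_cast hT1))
        have hν2 : ν ^ 2 ≤ L ^ 2 / T := by
          rw [hν, div_pow, Real.sq_sqrt hTpos.le]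
          gcongr
        have hνν₁ : ν < ν₁ := by
          rw [hν, div_lt_iff₀ hsq]
          have h1 : (L / ν₁) ^ 2 < T := by
            refine lt_of_le_of_lt (Nat.le_ceil _) ?_
            exact_mod_cast (by omega : ⌈(L / ν₁) ^ 2⌉₊ < T)
          have h2 := Real.lt_sqrt_of_sq_lt h1
          rw [div_lt_iff₀ hν₁] at h2
          linarith
        obtain ⟨w, hw, hwn⟩ := hroot ν hνpos hνν₁
        have hx0 : 0 ≤ K * L ^ 2 / T := by positivity
        have hx1 : K * L ^ 2 / T ≤ 1 / 2 := by
          rw [div_le_iff₀ hTpos]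
          have h1 : 2 * (K * L ^ 2) ≤ T := by
            refine (Nat.le_ceil _).trans ?_
            exact_mod_cast (by omega : ⌈2 * (K * L ^ 2)⌉₊ ≤ T)
          linarith
        have hwx : 1 - K * L ^ 2 / T ≤ ‖w‖ := by
          refine le_trans ?_ hwn
          have := mul_le_mul_of_nonneg_left hν2 hK
          rw [← mul_div_assoc] at this
          linarith
        have hexp : Real.exp (-(2 * (K * L ^ 2 / T))) ≤ ‖w‖ := by
          refine le_trans ?_ hwx
          rw [Real.exp_neg]
          refine inv_le_of_inv_le₀ (by linarith) ?_
          refine le_trans ?_ (Real.add_one_le_exp _)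
          rw [inv_le_iff_one_le_mul₀ (by linarith)]
          nlinarith
        rcases le_or_gt 1 ‖w‖ with hw1 | hw1
        · refine A.exists_instance_of_one_le_norm hm hD hνpos hνℓ hw hw1 T ?_
          rw [hν, mul_assoc, mul_div_assoc, div_mul_eq_mul_div]
          exact mul_le_of_le_one_left (by positivity) hc1
        · refine A.exists_instance_of_norm_le_one hp hm hD hνpos hνℓ hw ?_ hw1.le T ?_
          · rintro rfl
            rw [norm_zero] at hwx
            linarith
          · have hpow : Real.exp (-(4 * (K * L ^ 2))) ≤ ‖w‖ ^ (T + (p - 1)) := by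
              calc Real.exp (-(4 * (K * L ^ 2)))
                  = Real.exp (-(2 * (K * L ^ 2 / T))) ^ (2 * T) := by
                    rw [← Real.exp_nat_mul]
                    congr 1
                    push_cast
                    field_simp
                    ring
                _ ≤ ‖w‖ ^ (2 * T) := pow_le_pow_left₀ (Real.exp_pos _).le hexp _
                _ ≤ ‖w‖ ^ (T + (p - 1)) :=
                    pow_le_pow_of_le_one (norm_nonneg _) hw1.le (by omega)
            calc Real.exp (-(4 * (K * L ^ 2))) * ℓ * D ^ 2 / Real.sqrt T
                = ν * D * (D * Real.exp (-(4 * (K * L ^ 2)))) := by rw [hν]; ring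
              _ ≤ _ := by gcongr
  · -- the algorithm is inconsistent: its stationary point is not the equilibrium
    have hδpos : 0 < |δ| := abs_pos.mpr hδ0
    obtain ⟨c, hc⟩ : ∃ c, c = |δ| / (|δ| + 2 ^ p) := ⟨_, rfl⟩
    have hcpos : 0 < c := by rw [hc]; positivity
    have hc1 : c ≤ 1 := by
      rw [hc]
      exact div_le_one_of_le₀ (by linarith [pow_pos (two_pos (α := ℝ)) p]) (by positivity)
    refine ⟨c, 1, hcpos, one_pos, fun m hm ℓ D hℓ hD T hT => ?_⟩
    have hG := hlarge hcpos hℓ hD hT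
    rcases lt_or_ge (2 ^ p) (ℓ * |σ|) with h | h
    · obtain ⟨w, hw, hw1⟩ := hunstable ℓ hℓ h
      refine A.exists_instance_of_one_le_norm hm hD hℓ le_rfl hw hw1 T (hG.trans ?_)
      rw [mul_assoc]
      exact mul_le_of_le_one_left (by positivity) hc1
    · obtain ⟨q, hq⟩ : ∃ q : ℂ, q = δ + Complex.I * ℓ * σ := ⟨_, rfl⟩
      have hqδ : ‖q - δ‖ = ℓ * |σ| := by simp [hq, abs_of_pos hℓ]
      have hqim : ‖q - δ‖ ≤ ‖q‖ := by
        rw [hqδ]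
        have := Complex.abs_im_le_norm q
        simpa [hq, abs_mul, abs_of_pos hℓ] using this
      have hqre : |δ| ≤ ‖q‖ := by
        have := Complex.abs_re_le_norm q
        simpa [hq] using this
      have hqpos : 0 < ‖q‖ := hδpos.trans_le hqre
      have hq0 : q ≠ 0 := norm_pos_iff.mp hqpos
      have hqle : ‖q‖ ≤ |δ| + 2 ^ p := by
        have h1 := norm_add_le (δ : ℂ) (q - δ)
        rw [add_sub_cancel, hqδ, Complex.norm_real, Real.norm_eq_abs] at h1
        linarith
      refine A.exists_instance_of_stationary hm hD hℓ le_rfl (s := D) (e := -δ * D / q)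
        (abs_of_pos hD).le ?_ ?_ T (hG.trans ?_)
      · rw [hev, ← hq, ← hδ, mul_div_cancel₀ _ hq0]
      · have h1 : -δ * D / q + D = D * ((q - δ) / q) := by
          field_simp
          ring
        rw [h1, norm_mul, norm_div, Complex.norm_real, Real.norm_eq_abs, abs_of_pos hD]
        exact mul_le_of_le_one_right hD.le (div_le_one_of_le₀ hqim hqpos.le)
      · have h1 : ‖-δ * D / q‖ = |δ| * D / ‖q‖ := by simp [abs_of_pos hD]
        rw [h1, hc]
        calc |δ| / (|δ| + 2 ^ p) * ℓ * D ^ 2 = ℓ * D * (|δ| * D / (|δ| + 2 ^ p)) := by ring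
          _ ≤ ℓ * D * (|δ| * D / ‖q‖) := by gcongr
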